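/- **Pseudo-padded decomposition for general graphs.** Let $G=(V,E,\ell)$ be a finite undirected graph with $n$ nodes and nonnegative edge lengths, $d_G$ its weighted distance, $B(v,r)=\{u : d_G(v,u)\le r\}$, let $\mathcal X\subseteq V$ be a set of centers, $\mathcal D>0$, $\epsilon\ge 0$ and $\tau\in\mathbb N$. Suppose that for every $v\in V$ * (covering) there is a center $x\in\mathcal X$ with $d_G(v,x)\le\mathcal D$; * (packing) at most $\tau$ centers $x\in\mathcal X$ satisfy $d_G(v,x)\le 6\mathcal D$. Let $c\in\mathbb N$. *Model.* Nodes have unique identifiers of $w$ bits and independent private randomness, know $n$, $\mathcal D$, $\tau$, and compute in global steps of two kinds. (i) In a $(1+\epsilon)$-approximate SetSSP computation, virtual nodes with weighted edges are added to $G$ and a source set $S$ is chosen; every node $v\notin S$ that is connected to $S$ learns a neighbour as its predecessor, such that following predecessors leads to $S$, and learns its exact distance to $S$ in the resulting tree, which is at most $(1+\epsilon)d(v,S)$. Which such tree is returned is up to an arbitrary procedure. (ii) In a minor aggregation, the nodes select incident edges, and every node learns the aggregate, under a commutative and associative operation, of the inputs of all nodes in its connected component of the selected edges. *Algorithm.*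 Let $\lambda=2+2\log(\min\{\tau,n\})$. Every center $x$ independently draws $\delta'_x\sim\mathsf{Texp}(\lambda)$, the distribution on $[0,1]$ with density $\lambda e^{-\lambda t}/(1-e^{-\lambda})$, and sets $\delta_x=\mathcal D\lfloor n^{c+1}\delta'_x\rfloor/n^{c+1}$. A virtual source $s$ is joined to every center $x$ by an edge of weight $\mathcal D-\delta_x$, and a $(1+\epsilon)$-approximate SetSSP computation with source set $\{s\}$ is performed. Every node joins the cluster of the center that is adjacent to $s$ on its tree path to $s$; each part of the tree that remains after removing $s$ learns the identifier of this center by a minor aggregation. Let $K(v)$ be the cluster of $v$. Then there are a universal constant $C>0$ and a constant $C'>0$ that depends only on $c$ such that the following holds for all such $G,\mathcal X,\mathcal D,\epsilon,\tau$ and every $(1+\epsilon)$-approximate SetSSP procedure for $G$ that is correct when there is at most one virtual node and its edges have weight at most $\mathcal D$. 1. The algorithm uses exactly one SetSSP computation and one (hence $\tilde O(1)$) minor aggregation, with inputs of at most $w$ bits. 2. For every outcome of the random choices, every cluster is connected and has strong diameter at most $4(1+\epsilon)\mathcal D$: any two of its nodes are at distance at most $4(1+\epsilon)\mathcal D$ in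 the subgraph of $G$ induced by the cluster. 3. For every $v\in V$ and every $\gamma$ with $\epsilon\le\gamma\le\frac1{32}$, $$\Pr\bigl[B(v,\gamma\mathcal D)\subseteq K(v)\bigr]\;\ge\; e^{-C(\gamma+\epsilon)\log\tau}-\frac{C'}{n^{c}}.$$ -/

import Mathlib

open scoped NNReal ENNReal

noncomputable section

namespace PseudoPadded

/-! ### Weighted graphs -/

/-- An undirected graph with nonnegative edge lengths. -/
structure WGraph (V : Type*) where
  graph : SimpleGraph V
  /-- the length of an edge; its value off the edge set is irrelevant -/
  len : Sym2 V → ℝ≥0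

namespace WGraph

variable {V : Type*}

/-- The length of a walk. -/
def walkLen (G : WGraph V) {u v : V} (p : G.graph.Walk u v) : ℝ≥0 :=
  (p.edges.map G.len).sum

/-- The weighted distance `d_G(u,v)`; it is `∞` if `u` and `v` are not connected. -/
def dist (G : WGraph V) (u v : V) : ℝ≥0∞ :=
  ⨅ p : G.graph.Walk u v, (G.walkLen p : ℝ≥0∞)

/-- The distance `d_G(v,S)` to a set. -/
def distTo (G : WGraph V) (S : Set V) (v : V) : ℝ≥0∞ :=
  ⨅ s ∈ S, G.dist v s

/-- The (closed) ball `B_G(v,r)`. -/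
def ball (G : WGraph V) (v : V) (r : ℝ≥0) : Set V :=
  {u | G.dist v u ≤ r}

/-- The induced weighted subgraph `G[K]`. -/
def induce (G : WGraph V) (K : Set V) : WGraph K where
  graph := G.graph.induce K
  len := fun e => G.len (e.map Subtype.val)

/-- `K` has strong diameter at most `r`: any two nodes of `K` are at distance at most `r`
inside `G[K]`. -/
def StrongDiamLE (G : WGraph V) (K : Set V) (r : ℝ≥0) : Prop :=
  ∀ u v : K, (G.induce K).dist u v ≤ r

end WGraph

/-! ### Approximate set-source shortest paths with virtual nodes -/

/-- The input of a set-source shortest path computation: `k` virtual nodes are added to the graph,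
with weighted edges to real nodes (`edge`) and among themselves (`vedge`), where `∞` means that
there is no edge, and a set `src` of real and virtual sources is chosen. -/
structure VirtualExt (V : Type*) (k : ℕ) where
  edge : V → Fin k → ℝ≥0∞
  vedge : Sym2 (Fin k) → ℝ≥0∞
  src : Set (V ⊕ Fin k)

namespace VirtualExt

variable {V : Type*} {k : ℕ}

/-- Adjacency in the graph with virtual nodes. -/
def Adj (I : VirtualExt V k) (G : WGraph V) : V ⊕ Fin k → V ⊕ Fin k → Prop
  | .inl u, .inl v => G.graph.Adj u v
  | .inl u, .inr i => I.edge u i ≠ ∞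
  | .inr i, .inl u => I.edge u i ≠ ∞
  | .inr i, .inr j => i ≠ j ∧ I.vedge s(i, j) ≠ ∞

/-- Edge lengths in the graph with virtual nodes. -/
def lenFun (I : VirtualExt V k) (G : WGraph V) : V ⊕ Fin k → V ⊕ Fin k → ℝ≥0
  | .inl u, .inl v => G.len s(u, v)
  | .inl u, .inr i => (I.edge u i).toNNReal
  | .inr i, .inl u => (I.edge u i).toNNReal
  | .inr i, .inr j => (I.vedge s(i, j)).toNNReal

theorem lenFun_comm (I : VirtualExt V k) (G : WGraph V) (a b : V ⊕ Fin k) :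
    I.lenFun G a b = I.lenFun G b a := by
  rcases a with u | i <;> rcases b with v | j <;> simp [lenFun, Sym2.eq_swap]

/-- The graph with the virtual nodes added. -/
def extend (I : VirtualExt V k) (G : WGraph V) : WGraph (V ⊕ Fin k) where
  graph :=
    { Adj := I.Adj G
      symm := ⟨by
        rintro (u | i) (v | j) h
        · exact SimpleGraph.Adj.symm h
        · exact h
        · exact h
        · exact ⟨h.1.symm, by rw [Sym2.eq_swap]; exact h.2⟩⟩
      loopless := ⟨by
        rintro (u | i) h
        · exact G.graph.irrefl h
        · exact h.1 rfl⟩ }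
  len := Sym2.lift ⟨I.lenFun G, I.lenFun_comm G⟩

/-- All virtual edges have weight at most `W`. -/
def WeightLE (I : VirtualExt V k) (W : ℝ≥0) : Prop :=
  (∀ u i, I.edge u i ≠ ∞ → I.edge u i ≤ W) ∧ ∀ e, I.vedge e ≠ ∞ → I.vedge e ≤ W

end VirtualExt

/-- `pred` and `d` form a `(1+ε)`-approximate shortest path forest of `H` rooted in `S`: every node
outside `S` (connected to `S` at all) has a predecessor among its neighbours, following
predecessors leads to `S`, and `d v` is the exact distance of `v` to `S` along the tree, which is
at most `(1+ε)` times the distance in `H`. -/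
def IsApproxSSP {W : Type*} (H : WGraph W) (S : Set W) (ε : ℝ≥0) (pred : W → W) (d : W → ℝ≥0) :
    Prop :=
  (∀ v ∈ S, d v = 0) ∧
  ∀ v ∉ S, H.distTo S v ≠ ∞ →
    H.graph.Adj v (pred v) ∧
    (∃ m : ℕ, pred^[m] v ∈ S) ∧
    d v = H.len s(v, pred v) + d (pred v) ∧
    (d v : ℝ≥0∞) ≤ ((1 + ε : ℝ≥0) : ℝ≥0∞) * H.distTo S v

/-- A procedure that answers set-source shortest path computations on a fixed node set: it returns
the predecessors and the tree distances. -/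
def SetSSPAlg (V : Type*) : Type _ :=
  (k : ℕ) → VirtualExt V k → (V ⊕ Fin k → V ⊕ Fin k) × (V ⊕ Fin k → ℝ≥0)

/-- The procedure `A` solves `(1+ε)`-approximate set-source shortest paths on `G` with at most `k₀`
virtual nodes whose edges have weight at most `W`. -/
def SetSSPAlg.Solves {V : Type*} (A : SetSSPAlg V) (G : WGraph V) (ε : ℝ≥0) (k₀ : ℕ) (W : ℝ≥0) :
    Prop :=
  ∀ k ≤ k₀, ∀ I : VirtualExt V k, I.WeightLE W →
    IsApproxSSP (I.extend G) I.src ε (A k I).1 (A k I).2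

/-! ### A distributed model with shortest path and minor aggregation steps -/

/-- The network: a weighted graph in which every node has a unique identifier of `w` bits, and a
set of marked nodes, the possible cluster centers. -/
structure Network (w : ℕ) (V : Type*) where
  G : WGraph V
  ident : V → Fin (2 ^ w)
  ident_inj : Function.Injective ident
  centers : Set V

/-- What a node knows at the beginning: its identifier, whether it is a center, the identifiers of
its neighbours with the lengths of the edges to them (`∞` for non-neighbours), and a private random
number. -/
structure NodeInput (w : ℕ) where
  ident : Fin (2 ^ w)
  isCenter : Prop
  nbr : Fin (2 ^ w) → ℝ≥0∞
  coin : ℝ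

open Classical in
/-- The input of node `v` in the network `N` when the private random numbers are `ω`. -/
def Network.view {w : ℕ} {V : Type*} (N : Network w V) (ω : V → ℝ) (v : V) : NodeInput w where
  ident := N.ident v
  isCenter := v ∈ N.centers
  nbr := fun i =>
    if h : ∃ u, N.G.graph.Adj v u ∧ N.ident u = i then (N.G.len s(v, h.choose) : ℝ≥0∞) else ∞
  coin := ω v

/-- A global step; `σ` is the type of states of a node, and all functions are evaluated by each node
on its own state.

* `setSSP`: a set-source shortest path computation with `k` virtual nodes. A node chooses its edges
  to the virtual nodes and whether it is a source; it learns its predecessor (an identifier, or a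
  virtual node) and its distance in the tree.
* `minorAgg`: a minor aggregation. A node selects incident edges (by the identifier of the other
  endpoint). The selected edges partition the graph into connected parts. Every node has a private
  input of `b` bits, and it learns the aggregate, under a commutative and associative operation, of
  the inputs in its part. -/
inductive Instr (w : ℕ) (σ : Type) : Type
  | setSSP (k : ℕ) (edge : σ → Fin k → ℝ≥0∞) (vedge : Sym2 (Fin k) → ℝ≥0∞)
      (src : σ → Prop) (vsrc : Fin k → Prop) (upd : σ → Fin (2 ^ w) ⊕ Fin k → ℝ≥0 → σ)
  | minorAgg (b : ℕ) (op : Fin (2 ^ b) → Fin (2 ^ b) → Fin (2 ^ b))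
      (_comm : Std.Commutative op) (_assoc : Std.Associative op) (e : Fin (2 ^ b))
      (sel : σ → Fin (2 ^ w) → Prop) (inp : σ → Fin (2 ^ b)) (upd : σ → Fin (2 ^ b) → σ)

namespace Instr

variable {w : ℕ} {σ : Type}

/-- The number of set-source shortest path computations of a step. -/
def sspCost : Instr w σ → ℕ
  | setSSP .. => 1
  | minorAgg .. => 0

/-- The number of minor aggregations of a step. -/
def aggCost : Instr w σ → ℕ
  | setSSP .. => 0
  | minorAgg .. => 1

/-- The number of bits of a private input to the aggregation. -/
def bits : Instr w σ → ℕ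
  | setSSP .. => 0
  | minorAgg b .. => b

/-- The graph of the edges selected by at least one endpoint; its components are the parts. -/
def partGraph {V : Type*} (N : Network w V) (sel : σ → Fin (2 ^ w) → Prop) (st : V → σ) :
    SimpleGraph V where
  Adj u v := N.G.graph.Adj u v ∧ (sel (st u) (N.ident v) ∨ sel (st v) (N.ident u))
  symm := ⟨fun _ _ h => ⟨h.1.symm, h.2.symm⟩⟩
  loopless := ⟨fun _ h => N.G.graph.irrefl h.1⟩

open Classical in
/-- The effect of a step on the states of the nodes; `A` answers the shortest path computations. -/
def exec {V : Type*} [Fintype V] (N : Network w V) (A : SetSSPAlg V) (st : V → σ) :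
    Instr w σ → V → σ
  | setSSP k edge vedge src vsrc upd => fun v =>
      let I : VirtualExt V k :=
        ⟨fun u => edge (st u), vedge, {a | Sum.elim (fun u => src (st u)) vsrc a}⟩
      upd (st v) (Sum.map N.ident id ((A k I).1 (.inl v))) ((A k I).2 (.inl v))
  | minorAgg _ op _ _ e sel inp upd => fun v =>
      upd (st v) ((Finset.univ.filter fun u => (partGraph N sel st).Reachable v u).fold op e
        fun u => inp (st u))

end Instr

/-- A distributed clustering algorithm: the law of the private random numbers, the initial state of
a node, the global steps, and the label of the cluster that a node finally joins. -/
structure Program (w : ℕ) (σ : Type) where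
  coinLaw : MeasureTheory.Measure ℝ
  init : NodeInput w → σ
  steps : List (Instr w σ)
  label : σ → Fin (2 ^ w)

namespace Program

variable {w : ℕ} {σ : Type}

/-- The number of set-source shortest path computations. -/
def numSetSSP (P : Program w σ) : ℕ := (P.steps.map Instr.sspCost).sum

/-- The number of minor aggregations. -/
def numMinorAgg (P : Program w σ) : ℕ := (P.steps.map Instr.aggCost).sum

variable {V : Type*} [Fintype V]

/-- The final states of the nodes. -/
def run (P : Program w σ) (N : Network w V) (A : SetSSPAlg V) (ω : V → ℝ) : V → σ :=
  P.steps.foldl (fun st i => i.exec N A st) fun v => P.init (N.view ω v)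

/-- The cluster `K(v)` that contains `v`: the nodes with the same label as `v`. -/
def cluster (P : Program w σ) (N : Network w V) (A : SetSSPAlg V) (ω : V → ℝ) (v : V) : Set V :=
  {u | P.label (P.run N A ω u) = P.label (P.run N A ω v)}

/-- The joint law of the private random numbers: they are independent. -/
def law (P : Program w σ) (V : Type*) [Fintype V] : MeasureTheory.Measure (V → ℝ) :=
  MeasureTheory.Measure.pi fun _ : V => P.coinLaw

end Program

/-! ### The clustering algorithm -/

/-- The exponential distribution with parameter `lam`, truncated to `[0,1]`. -/
def texp (lam : ℝ) : MeasureTheory.Measure ℝ :=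
  (MeasureTheory.volume.restrict (Set.Icc 0 1)).withDensity fun x =>
    ENNReal.ofReal (lam * Real.exp (-x * lam) / (1 - Real.exp (-lam)))

/-- The shift `δ = D * x`, rounded down to a multiple of `D / m`. -/
def shift (D : ℝ≥0) (m : ℕ) (x : ℝ) : ℝ≥0 := D * (⌊m * x⌋₊ / m)

/-- The state of a node in the clustering algorithm. -/
structure PadState (w : ℕ) where
  view : NodeInput w
  pred : Fin (2 ^ w) ⊕ Fin 1
  label : Fin (2 ^ w)

open Classical in
/-- The clustering algorithm for `n` nodes, distance parameter `D` and packing parameter `τ`.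
Every center `x` draws a shift `δ_x ∼ D * Texp(2 + 2 log τ)`, rounded to precision
`D / n ^ (c + 1)`. (There are never more than `n` centers, so a value `τ > n` is replaced by `n`.)
A virtual source is joined to every center `x` by an edge of weight `D - δ_x`, and approximate
shortest paths from the virtual source are computed. Every node joins the cluster of the center
that precedes the virtual source on its path in the tree: the tree edges between real nodes are
selected, and in each part the center announces its identifier. -/
def paddedDecomposition (w n τ c : ℕ) (D : ℝ≥0) : Program w (PadState w) where
  coinLaw := texp (2 + 2 * Real.log (min τ n : ℕ))
  init := fun a => ⟨a, .inr 0, 0⟩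
  steps :=
    [ .setSSP 1
        (fun s _ =>
          if s.view.isCenter then ((D - shift D (n ^ (c + 1)) s.view.coin : ℝ≥0) : ℝ≥0∞) else ∞)
        (fun _ => ∞) (fun _ => False) (fun _ => True)
        (fun s p _ => { s with pred := p }),
      .minorAgg w max inferInstance inferInstance 0
        (fun s i => s.pred = .inl i)
        (fun s => if s.pred = .inr 0 then s.view.ident else 0)
        (fun s x => { s with label := x }) ]
  label := PadState.label

end PseudoPadded

end

/-! Put `δ_x` for the shift at `x`. The tree sends `u` to a center `z`, its root, whose cost `d(u,z)
+ D - δ_z`, even measured along the tree path, is at most `1 + ε` times the cost of every other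
center. Every node on this tree path has the same root, so the path stays in the cluster. By
covering, some center costs at most `2D`, so the path is no longer than `2(1 + ε)D`; joining two
such paths at the root bounds the strong diameter (`exists_root`, `strongDiamLE_cluster`).

For padding, only centers within `6D` of `v` can be roots of nodes in the ball. If among these one
center maximizes `ω x - d(v,x)/D` with a margin above `2γ + 3ε`, plus the rounding precision, it is
the root of the whole ball (`ball_subset_cluster_of_gap`).

The margin is controlled by the near-memorylessness of the truncated exponential (`texp_window_le`).
With all other coins fixed, winning narrowly costs at most `1 - e^(-ρλ)` times the probability of
winning strictly, plus a truncation term. Strict wins are disjoint, so summing over the near centers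
leaves a total truncation error of `T / (e^λ - 1)` at most, with `T = min τ n` (`pi_texp_gap`).
Since `e^λ = e²T²`, this error only doubles the exponent (`exp_le_one_sub_window`). -/

namespace PseudoPadded

/-! ### Walk lengths and weighted distance -/

namespace WGraph

variable {V : Type*} (G : WGraph V)

theorem walkLen_append {u v w : V} (p : G.graph.Walk u v) (q : G.graph.Walk v w) :
    G.walkLen (p.append q) = G.walkLen p + G.walkLen q := by
  simp [walkLen, SimpleGraph.Walk.edges_append]

theorem walkLen_reverse {u v : V} (p : G.graph.Walk u v) :
    G.walkLen p.reverse = G.walkLen p := by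
  simp [walkLen, SimpleGraph.Walk.edges_reverse, List.sum_reverse]

theorem walkLen_cons {u v w : V} (h : G.graph.Adj u v) (p : G.graph.Walk v w) :
    G.walkLen (p.cons h) = G.len s(u, v) + G.walkLen p := by
  simp [walkLen]

theorem dist_le_walkLen {u v : V} (p : G.graph.Walk u v) : G.dist u v ≤ G.walkLen p :=
  iInf_le _ p

theorem dist_comm (u v : V) : G.dist u v = G.dist v u := by
  have key : ∀ a b : V, G.dist a b ≤ G.dist b a := fun a b =>
    le_iInf fun p => (G.dist_le_walkLen p.reverse).trans (by rw [walkLen_reverse])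
  exact le_antisymm (key u v) (key v u)

theorem dist_triangle (u v w : V) : G.dist u w ≤ G.dist u v + G.dist v w := by
  refine ENNReal.le_iInf_add_iInf fun p q => ?_
  have := G.dist_le_walkLen (p.append q)
  rwa [walkLen_append, ENNReal.coe_add] at this

theorem mem_ball_self (v : V) (r : ℝ≥0) : v ∈ G.ball v r :=
  (G.dist_le_walkLen .nil).trans (by simp [walkLen])

theorem walkLen_induce {K : Set V} {u v : V} (p : G.graph.Walk u v) (hp : ∀ x ∈ p.support, x ∈ K) :
    (G.induce K).walkLen (p.induce K hp) = G.walkLen p := by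
  induction p with
  | nil => rfl
  | cons h p ih =>
    rw [SimpleGraph.Walk.induce, walkLen_cons]
    refine (walkLen_cons ..).trans ?_
    congr 1
    exact ih _

end WGraph

/-! ### Distances after adding virtual nodes -/

namespace VirtualExt

variable {V : Type*} {k : ℕ} (I : VirtualExt V k) (G : WGraph V)

/-- Adding virtual nodes does not change the edges between real nodes. -/
def inlHom : G.graph →g (I.extend G).graph where
  toFun := Sum.inl
  map_rel' h := h

theorem walkLen_map_inlHom {u v : V} (p : G.graph.Walk u v) :
    (I.extend G).walkLen (p.map (I.inlHom G)) = G.walkLen p := by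
  induction p with
  | nil => simp [WGraph.walkLen]
  | cons h p ih =>
    rw [SimpleGraph.Walk.map_cons, WGraph.walkLen_cons, WGraph.walkLen_cons, ih]
    rfl

/-- Only this direction is needed: the approximation guarantee is an upper bound, to be compared
with the route through each candidate `x`. -/
theorem dist_inl_inr_le (u x : V) (i : Fin k) :
    (I.extend G).dist (.inl u) (.inr i) ≤ G.dist u x + I.edge x i := by
  by_cases hx : I.edge x i = ∞
  · simp [hx]
  have hadj : (I.extend G).graph.Adj (.inl x) (.inr i) := hx
  unfold WGraph.dist
  rw [ENNReal.iInf_add]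
  refine le_iInf fun p => ?_
  let q : (I.extend G).graph.Walk (.inl u) (.inl x) := p.map (I.inlHom G)
  have hq : (I.extend G).walkLen q = G.walkLen p := I.walkLen_map_inlHom G p
  refine (iInf_le _ (q.append hadj.toWalk)).trans ?_
  rw [WGraph.walkLen_append, hq]
  have : (I.extend G).walkLen hadj.toWalk = (I.edge x i).toNNReal := by
    rw [SimpleGraph.Adj.toWalk, WGraph.walkLen_cons]
    simp [WGraph.walkLen, extend, lenFun]
  rw [this, ENNReal.coe_add, ENNReal.coe_toNNReal hx]

end VirtualExt

/-! ### Roots in the shortest path tree of one virtual source -/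

/-- `RootOf pr u x`: following the predecessors `pr` from `u`, the last real node before the
virtual source is `x`. -/
inductive RootOf {V : Type*} (pr : V → V ⊕ Fin 1) : V → V → Prop
  | base {x : V} (h : pr x = .inr 0) : RootOf pr x x
  | step {u u' x : V} (h : pr u = .inl u') (hr : RootOf pr u' x) : RootOf pr u x

namespace RootOf

variable {V : Type*} {pr : V → V ⊕ Fin 1}

theorem unique {u x y : V} (hx : RootOf pr u x) (hy : RootOf pr u y) : x = y := by
  induction hx with
  | base h => cases hy with
    | base => rfl
    | step h' => simp [h] at h'
  | step h _ ih => cases hy with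
    | base h' => simp [h] at h'
    | step h' hr =>
      rw [h] at h'
      exact ih (Sum.inl_injective h' ▸ hr)

theorem pred_root {u x : V} (hx : RootOf pr u x) : pr x = .inr 0 := by
  induction hx with
  | base h => exact h
  | step _ _ ih => exact ih

theorem of_pred {u u' x : V} (h : pr u = .inl u') (hr : RootOf pr u x) : RootOf pr u' x := by
  cases hr with
  | base h' => simp [h] at h'
  | step h' hr =>
    rw [h] at h'
    exact Sum.inl_injective h' ▸ hr

/-- The path is cut at its first virtual node, which must be the source; the behaviour of `f` beyond
it is irrelevant. -/
theorem exists_of_iterate {f : V ⊕ Fin 1 → V ⊕ Fin 1} (m : ℕ) :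
    ∀ u : V, f^[m] (.inl u) = .inr 0 → ∃ x, RootOf (fun v => f (.inl v)) u x := by
  induction m with
  | zero => simp
  | succ m ih =>
    intro u hu
    rw [Function.iterate_succ_apply] at hu
    rcases h : f (.inl u) with u' | i
    · rw [h] at hu
      obtain ⟨x, hx⟩ := ih u' hu
      exact ⟨x, .step h hx⟩
    · exact ⟨u, .base (h.trans (by rw [Subsingleton.elim i 0]))⟩

end RootOf

/-- One virtual source, joined to the node `v` by an edge of weight `wt v`. -/
def sourceExt {V : Type*} (wt : V → ℝ≥0∞) : VirtualExt V 1 where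
  edge := fun v _ => wt v
  vedge := fun _ => ∞
  src := {a | Sum.elim (fun _ => False) (fun _ => True) a}

section Source

variable {V : Type*} {G : WGraph V} {wt : V → ℝ≥0∞} {ε : ℝ≥0}
  {f : V ⊕ Fin 1 → V ⊕ Fin 1} {d : V ⊕ Fin 1 → ℝ≥0}

theorem sourceExt_src (wt : V → ℝ≥0∞) : (sourceExt wt).src = {.inr 0} := by
  ext (v | i)
  · simp [sourceExt]
  · simp [sourceExt, Subsingleton.elim i 0]

theorem distTo_source_le (G : WGraph V) (wt : V → ℝ≥0∞) (u x : V) :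
    ((sourceExt wt).extend G).distTo (sourceExt wt).src (.inl u) ≤ G.dist u x + wt x := by
  rw [sourceExt_src]
  simp only [WGraph.distTo, Set.mem_singleton_iff, iInf_iInf_eq_left]
  exact (sourceExt wt).dist_inl_inr_le G u x 0

theorem inl_notMem_src (wt : V → ℝ≥0∞) (u : V) : Sum.inl u ∉ (sourceExt wt).src := by
  simp [sourceExt]

theorem distTo_source_ne_top (hconn : ∀ u, ∃ x, G.dist u x ≠ ∞ ∧ wt x ≠ ∞) (u : V) :
    ((sourceExt wt).extend G).distTo (sourceExt wt).src (.inl u) ≠ ∞ := by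
  obtain ⟨x, h1, h2⟩ := hconn u
  exact ne_top_of_le_ne_top (ENNReal.add_ne_top.2 ⟨h1, h2⟩) (distTo_source_le G wt u x)

theorem exists_rootOf
    (hS : IsApproxSSP ((sourceExt wt).extend G) (sourceExt wt).src ε f d)
    (hconn : ∀ u, ∃ x, G.dist u x ≠ ∞ ∧ wt x ≠ ∞) (u : V) :
    ∃ x, RootOf (fun v => f (.inl v)) u x := by
  obtain ⟨m, hm⟩ := (hS.2 _ (inl_notMem_src wt u) (distTo_source_ne_top hconn u)).2.1
  rw [sourceExt_src] at hm
  exact RootOf.exists_of_iterate m u hm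

/-- Unrolling `d v = len + d (pred v)` down to `d = 0` at the source gives the exact length. Nodes
on the walk share the root because their own tree paths are suffixes of it. -/
theorem RootOf.exists_walk {u x : V} (h : RootOf (fun v => f (.inl v)) u x)
    (hS : IsApproxSSP ((sourceExt wt).extend G) (sourceExt wt).src ε f d)
    (hconn : ∀ u, ∃ x, G.dist u x ≠ ∞ ∧ wt x ≠ ∞) :
    wt x ≠ ∞ ∧ ∃ p : G.graph.Walk u x,
      (∀ z ∈ p.support, RootOf (fun v => f (.inl v)) z x) ∧
      d (.inl u) = G.walkLen p + (wt x).toNNReal := by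
  induction h with
  | @base x h =>
    obtain ⟨hadj, -, hd, -⟩ := hS.2 _ (inl_notMem_src wt x) (distTo_source_ne_top hconn x)
    rw [h] at hadj hd
    refine ⟨hadj, .nil, by simpa using RootOf.base h, ?_⟩
    rw [hd, hS.1 (.inr 0) (by simp [sourceExt_src])]
    simp [WGraph.walkLen, VirtualExt.extend, VirtualExt.lenFun, sourceExt]
  | @step u u' x h hr ih =>
    obtain ⟨hadj, -, hd, -⟩ := hS.2 _ (inl_notMem_src wt u) (distTo_source_ne_top hconn u)
    rw [h] at hadj hd
    obtain ⟨hx, p, hp, hpd⟩ := ih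
    have hadj' : G.graph.Adj u u' := hadj
    refine ⟨hx, .cons hadj' p, ?_, ?_⟩
    · intro z hz
      rw [SimpleGraph.Walk.support_cons, List.mem_cons] at hz
      rcases hz with rfl | hz
      · exact .step h hr
      · exact hp z hz
    · rw [hd, hpd, WGraph.walkLen_cons, add_assoc]
      rfl

end Source

/-! ### Clusters as fibres of the root map; connectivity and diameter -/

section Clusters

variable {V : Type*} {w n τ c : ℕ} {N : Network w V} {D ε : ℝ≥0} {A : SetSSPAlg V}

open Classical in
/-- The weight of the edge between a node and the virtual source. -/
noncomputable def sourceWeight (N : Network w V) (D : ℝ≥0) (m : ℕ) (ω : V → ℝ) (v : V) : ℝ≥0∞ :=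
  if v ∈ N.centers then ((D - shift D m (ω v) : ℝ≥0) : ℝ≥0∞) else ∞

theorem sourceWeight_le (N : Network w V) (D : ℝ≥0) (m : ℕ) (ω : V → ℝ) {v : V}
    (hv : sourceWeight N D m ω v ≠ ∞) : sourceWeight N D m ω v ≤ D := by
  unfold sourceWeight at hv ⊢
  split_ifs at hv ⊢ with h
  · exact_mod_cast tsub_le_self
  · exact absurd rfl hv

/-- The predecessors of the nodes in the tree that the algorithm computes. -/
noncomputable def treePred (N : Network w V) (D : ℝ≥0) (m : ℕ) (A : SetSSPAlg V)
    (ω : V → ℝ) (v : V) : V ⊕ Fin 1 :=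
  (A 1 (sourceExt (sourceWeight N D m ω))).1 (.inl v)

variable [Fintype V]

open Classical in
theorem label_run (N : Network w V) (A : SetSSPAlg V) (ω : V → ℝ) (v : V) :
    (paddedDecomposition w n τ c D).label ((paddedDecomposition w n τ c D).run N A ω v) =
      (Finset.univ.filter fun u => (Instr.partGraph N
        (fun (s : PadState w) i => s.pred = .inl i)
        (fun u => ⟨N.view ω u, Sum.map N.ident id (treePred N D (n ^ (c + 1)) A ω u), 0⟩)).Reachable
          v u).fold max 0 fun u =>
        if Sum.map N.ident id (treePred N D (n ^ (c + 1)) A ω u) = .inr 0 then N.ident u else 0 := by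
  rfl

/-- The label of a node is the identifier of its root. -/
theorem label_run_eq {ω : V → ℝ}
    (hadj : ∀ u v, treePred N D (n ^ (c + 1)) A ω u = .inl v → N.G.graph.Adj u v)
    {v x : V} (hx : RootOf (treePred N D (n ^ (c + 1)) A ω) v x) :
    (paddedDecomposition w n τ c D).label ((paddedDecomposition w n τ c D).run N A ω v) =
      N.ident x := by
  classical
  rw [label_run]
  set pr := treePred N D (n ^ (c + 1)) A ω with hpr
  set H := Instr.partGraph N (fun (s : PadState w) i => s.pred = .inl i)
    (fun u => ⟨N.view ω u, Sum.map N.ident id (pr u), 0⟩) with hH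
  have hmap : ∀ u v, Sum.map N.ident id (pr u) = .inl (N.ident v) ↔ pr u = .inl v := by
    intro u v
    rcases pr u with a | i <;> simp [N.ident_inj.eq_iff]
  have hmap' : ∀ u, Sum.map N.ident id (pr u) = .inr 0 ↔ pr u = .inr 0 := by
    intro u
    rcases pr u with a | i <;> simp
  have hHadj : ∀ u v, H.Adj u v ↔ N.G.graph.Adj u v ∧ (pr u = .inl v ∨ pr v = .inl u) := by
    intro u v
    simp only [hH, Instr.partGraph, hmap]
  -- A selected edge is a predecessor edge in one of its two directions, and the root is invariant
  -- under both.
  have hroot : ∀ u, H.Reachable v u → RootOf pr u x := by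
    rintro u ⟨p⟩
    induction p with
    | nil => exact hx
    | cons h _ ih =>
      refine ih ?_
      rcases ((hHadj _ _).1 h).2 with h | h
      · exact hx.of_pred h
      · exact .step h hx
  have hreach : H.Reachable v x := by
    clear hroot
    induction hx with
    | base => exact .rfl
    | step h _ ih => exact .trans (SimpleGraph.Adj.reachable ((hHadj _ _).2 ⟨hadj _ _ h, .inl h⟩)) ih
  -- Only the root contributes its identifier to its part. All other nodes contribute `0`, neutral
  -- for `max`, so even a root with identifier `0` is labelled correctly.
  apply le_antisymm
  · rw [Finset.fold_max_le]
    refine ⟨Fin.zero_le _, fun u hu => ?_⟩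
    split_ifs with h
    · rw [hmap'] at h
      rw [(hroot u (Finset.mem_filter.1 hu).2).unique (.base h)]
    · exact Fin.zero_le _
  · rw [Finset.le_fold_max]
    exact .inr ⟨x, by simpa using hreach, by rw [if_pos ((hmap' x).2 hx.pred_root)]⟩

/-- Every node has a center `root` at the end of its tree path, the clusters are the sets of nodes
with the same root, and the tree paths stay inside the clusters. -/
theorem exists_root (hcov : ∀ v : V, ∃ x ∈ N.centers, N.G.dist v x ≤ D)
    (hA : A.Solves N.G ε 1 D) (ω : V → ℝ) :
    ∃ root : V → V,
      (∀ v, (paddedDecomposition w n τ c D).cluster N A ω v = {u | root u = root v}) ∧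
      ∀ u, root u ∈ N.centers ∧ ∃ p : N.G.graph.Walk u (root u),
        (∀ z ∈ p.support, root z = root u) ∧
        ∀ x ∈ N.centers, (N.G.walkLen p : ℝ≥0∞) + (D - shift D (n ^ (c + 1)) (ω (root u)) : ℝ≥0) ≤
          (1 + ε : ℝ≥0) * (N.G.dist u x + (D - shift D (n ^ (c + 1)) (ω x) : ℝ≥0)) := by
  have hwt : ∀ x ∈ N.centers, sourceWeight N D (n ^ (c + 1)) ω x =
      (D - shift D (n ^ (c + 1)) (ω x) : ℝ≥0) := fun x hx => if_pos hx
  have hS := hA 1 le_rfl (sourceExt (sourceWeight N D (n ^ (c + 1)) ω))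
    ⟨fun u _ h => sourceWeight_le N D _ ω h, fun e h => absurd rfl h⟩
  have hconn : ∀ u, ∃ x, N.G.dist u x ≠ ∞ ∧ sourceWeight N D (n ^ (c + 1)) ω x ≠ ∞ := fun u => by
    obtain ⟨x, hx, hd⟩ := hcov u
    exact ⟨x, ne_top_of_le_ne_top ENNReal.coe_ne_top hd, by simp [hwt x hx]⟩
  have hadj : ∀ u v, treePred N D (n ^ (c + 1)) A ω u = .inl v → N.G.graph.Adj u v := by
    intro u v h
    have h1 := (hS.2 _ (inl_notMem_src _ u) (distTo_source_ne_top hconn u)).1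
    rw [treePred] at h
    rw [h] at h1
    exact h1
  choose root hroot using exists_rootOf hS hconn
  refine ⟨root, fun v => ?_, fun u => ?_⟩
  · ext u
    simp only [Program.cluster, Set.mem_ofPred_eq]
    rw [label_run_eq hadj (hroot u), label_run_eq hadj (hroot v), N.ident_inj.eq_iff]
  · obtain ⟨hx, p, hp, hd⟩ := (hroot u).exists_walk hS hconn
    have hcen : root u ∈ N.centers := by
      by_contra h
      exact hx (if_neg h)
    refine ⟨hcen, p, fun z hz => (hroot z).unique (hp z hz), fun x hx => ?_⟩
    -- The tree distance is the length of `p` plus the last edge weight; the optimum is at most the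
    -- cost of the route through `x`.
    have h1 := (hS.2 _ (inl_notMem_src _ u) (distTo_source_ne_top hconn u)).2.2.2
    rw [hd, hwt _ hcen, ENNReal.toNNReal_coe, ENNReal.coe_add] at h1
    refine h1.trans ?_
    gcongr
    exact (distTo_source_le _ _ u x).trans (by rw [hwt x hx])

theorem strongDiamLE_cluster (hcov : ∀ v : V, ∃ x ∈ N.centers, N.G.dist v x ≤ D)
    (hA : A.Solves N.G ε 1 D) (ω : V → ℝ) (v : V) :
    N.G.StrongDiamLE ((paddedDecomposition w n τ c D).cluster N A ω v) (4 * (1 + ε) * D) := by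
  obtain ⟨root, hcl, hroot⟩ := exists_root (n := n) (τ := τ) (c := c) hcov hA ω
  rw [hcl]
  have key : ∀ u (hu : root u = root v), ∃ hr : root u ∈ {u | root u = root v},
      (N.G.induce {u | root u = root v}).dist ⟨u, hu⟩ ⟨root u, hr⟩ ≤ (2 * (1 + ε) * D : ℝ≥0) := by
    intro u hu
    obtain ⟨-, p, hp, hd⟩ := hroot u
    have hp' : ∀ z ∈ p.support, z ∈ {u | root u = root v} := fun z hz => (hp z hz).trans hu
    refine ⟨hp' _ p.end_mem_support, ?_⟩
    refine (WGraph.dist_le_walkLen _ (p.induce _ hp')).trans ?_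
    rw [WGraph.walkLen_induce]
    obtain ⟨x, hx, hux⟩ := hcov u
    calc (N.G.walkLen p : ℝ≥0∞) ≤ _ := le_self_add
      _ ≤ _ := hd x hx
      _ ≤ (1 + ε : ℝ≥0) * ((D : ℝ≥0∞) + D) := by
        gcongr
        exact tsub_le_self
      _ = (2 * (1 + ε) * D : ℝ≥0) := by push_cast; ring
  rintro ⟨a, ha⟩ ⟨b, hb⟩
  obtain ⟨hr, ha'⟩ := key a ha
  obtain ⟨hr', hb'⟩ := key b hb
  have hab : (⟨root b, hr'⟩ : {u | root u = root v}) = ⟨root a, hr⟩ := Subtype.ext (hb.trans ha.symm)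
  rw [hab, WGraph.dist_comm] at hb'
  refine (WGraph.dist_triangle _ _ ⟨root a, hr⟩ _).trans ?_
  refine (add_le_add ha' hb').trans ?_
  rw [← ENNReal.coe_add]
  exact ENNReal.coe_le_coe.2 (le_of_eq (by ring))

/-- A finite distance forces a walk, as the infimum over no walks is `∞`. -/
theorem connected_cluster (hcov : ∀ v : V, ∃ x ∈ N.centers, N.G.dist v x ≤ D)
    (hA : A.Solves N.G ε 1 D) (ω : V → ℝ) (v : V) :
    (N.G.graph.induce ((paddedDecomposition w n τ c D).cluster N A ω v)).Connected := by
  have : Nonempty ((paddedDecomposition w n τ c D).cluster N A ω v) := ⟨⟨v, rfl⟩⟩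
  refine ⟨fun a b => ?_⟩
  have h := strongDiamLE_cluster (n := n) (τ := τ) (c := c) hcov hA ω v a b
  by_contra hab
  have hab' : IsEmpty ((N.G.induce
      ((paddedDecomposition w n τ c D).cluster N A ω v)).graph.Walk a b) := not_nonempty_iff.1 hab
  rw [WGraph.dist, iInf_of_empty] at h
  exact ENNReal.coe_ne_top (top_le_iff.1 h)

end Clusters

open MeasureTheory

/-! ### The truncated exponential distribution -/

section Texp

variable {lam : ℝ}

theorem texp_Icc (hl : 0 < lam) {a b : ℝ} (ha : 0 ≤ a) (hab : a ≤ b) (hb : b ≤ 1) :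
    texp lam (Set.Icc a b) = ENNReal.ofReal
      ((Real.exp (-(lam * a)) - Real.exp (-(lam * b))) / (1 - Real.exp (-lam))) := by
  have hZ : 0 < 1 - Real.exp (-lam) := by simp [hl]
  have hsub : Set.Icc a b ⊆ Set.Icc 0 1 := Set.Icc_subset_Icc ha hb
  rw [texp, withDensity_apply _ measurableSet_Icc, Measure.restrict_restrict measurableSet_Icc,
    Set.inter_eq_left.2 hsub, ← ofReal_integral_eq_lintegral_ofReal]
  · congr 1
    rw [integral_Icc_eq_integral_Ioc, ← intervalIntegral.integral_of_le hab]
    have hderiv : ∀ x ∈ Set.uIcc a b, HasDerivAt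
        (fun x => -Real.exp (-(lam * x)) / (1 - Real.exp (-lam)))
        (lam * Real.exp (-x * lam) / (1 - Real.exp (-lam))) x := by
      intro x _
      have h1 : HasDerivAt (fun x => -(lam * x)) (-(lam * 1)) x :=
        ((hasDerivAt_id x).const_mul lam).neg
      refine ((h1.exp.neg).div_const (1 - Real.exp (-lam))).congr_deriv ?_
      rw [show -x * lam = -(lam * x) by ring]
      ring
    rw [intervalIntegral.integral_eq_sub_of_hasDerivAt hderiv
      (Continuous.intervalIntegrable (by fun_prop) _ _)]
    ring
  · exact (Continuous.integrableOn_Icc (by fun_prop))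
  · exact Filter.Eventually.of_forall fun x => by positivity

theorem texp_compl_Icc (lam : ℝ) : texp lam (Set.Icc 0 1)ᶜ = 0 := by
  rw [texp]
  refine withDensity_absolutelyContinuous _ _ ?_
  rw [Measure.restrict_apply measurableSet_Icc.compl, Set.compl_inter_self, measure_empty]

theorem isProbabilityMeasure_texp (hl : 0 < lam) : IsProbabilityMeasure (texp lam) := by
  have hZ : 0 < 1 - Real.exp (-lam) := by simp [hl]
  refine ⟨?_⟩
  rw [← measure_add_measure_compl (measurableSet_Icc (a := (0 : ℝ)) (b := 1)), texp_compl_Icc,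
    texp_Icc hl le_rfl zero_le_one le_rfl]
  simp [div_self hZ.ne']

/-- The window bound for a truncated exponential variable: it hits a window of width `ρ` above `r`
with probability at most `1 - e ^ (-ρ λ)` times that of exceeding `r`, up to a truncation error. -/
theorem texp_window_le (hl : 0 < lam) {r ρ : ℝ} (hρ : 0 ≤ ρ) :
    texp lam (Set.Icc r (r + ρ)) ≤ ENNReal.ofReal (1 - Real.exp (-(ρ * lam))) *
      (texp lam (Set.Ioi r) + ENNReal.ofReal (1 / (Real.exp lam - 1))) := by
  have hZ : 0 < 1 - Real.exp (-lam) := by simp [hl]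
  by_cases hr : r + ρ < 0 ∨ 1 < r
  · have : texp lam (Set.Icc r (r + ρ)) = 0 := by
      refine measure_mono_null (t := (Set.Icc 0 1)ᶜ) (fun x hx => ?_) (texp_compl_Icc lam)
      intro hx'
      rcases hr with hr | hr
      · linarith [hx.2, hx'.1]
      · linarith [hx.1, hx'.2]
    simp [this]
  push Not at hr
  set a := max r 0
  set b := min (r + ρ) 1
  have ha0 : 0 ≤ a := le_max_right _ _
  have ha1 : a ≤ 1 := max_le hr.2 zero_le_one
  have hab : a ≤ b := max_le (le_min (by linarith) hr.2) (le_min hr.1 zero_le_one)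
  have hb1 : b ≤ 1 := min_le_right _ _
  have hba : b ≤ a + ρ := (min_le_left _ _).trans (by linarith [le_max_left r 0])
  have hup : texp lam (Set.Icc r (r + ρ)) ≤ texp lam (Set.Icc a b) := by
    rw [← measure_inter_add_sdiff (Set.Icc r (r + ρ)) (measurableSet_Icc (a := (0 : ℝ)) (b := 1)),
      measure_mono_null (Set.sdiff_subset_compl _ _) (texp_compl_Icc lam), add_zero]
    exact measure_mono fun x hx => ⟨max_le hx.1.1 hx.2.1, le_min hx.1.2 hx.2.2⟩
  -- Absence of atoms allows the strict event `Ioi r` on the right, which later makes the winning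
  -- events disjoint.
  have hnull : texp lam {a} = 0 := by
    rw [← Set.Icc_self, texp_Icc hl ha0 le_rfl ha1]
    simp
  have hlow : texp lam (Set.Icc a 1) ≤ texp lam (Set.Ioi r) := by
    calc texp lam (Set.Icc a 1) ≤ texp lam ({a} ∪ Set.Ioi r) := by
          refine measure_mono fun x hx => ?_
          rcases hx.1.eq_or_lt with h | h
          · exact .inl h.symm
          · exact .inr ((le_max_left r 0).trans_lt h)
      _ ≤ texp lam {a} + texp lam (Set.Ioi r) := measure_union_le _ _
      _ = _ := by rw [hnull, zero_add]
  have he : 0 < Real.exp lam - 1 := by simpa using hl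
  have hK : 0 ≤ 1 - Real.exp (-(ρ * lam)) := by
    have : 0 ≤ ρ * lam := by positivity
    simpa using this
  have hmono : Real.exp (-lam) ≤ Real.exp (-(lam * a)) := Real.exp_le_exp.2 (by nlinarith)
  calc _ ≤ texp lam (Set.Icc a b) := hup
    _ ≤ ENNReal.ofReal ((1 - Real.exp (-(ρ * lam))) *
        ((Real.exp (-(lam * a)) - Real.exp (-(lam * 1))) / (1 - Real.exp (-lam)) +
          1 / (Real.exp lam - 1))) := by
      rw [texp_Icc hl ha0 hab hb1]
      refine ENNReal.ofReal_le_ofReal ?_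
      -- The truncation error is the tail beyond `1` of the untruncated law, rescaled. Adding it
      -- back leaves `e^(-λa)`, and memorylessness becomes exact.
      have h1 : 1 / (Real.exp lam - 1) = Real.exp (-lam) / (1 - Real.exp (-lam)) := by
        rw [div_eq_div_iff he.ne' hZ.ne', mul_sub (Real.exp (-lam)),
          ← Real.exp_add]
        simp
      rw [h1, ← add_div, mul_one, sub_add_cancel, ← mul_div_assoc]
      gcongr
      have h2 : Real.exp (-(ρ * lam)) * Real.exp (-(lam * a)) ≤ Real.exp (-(lam * b)) := by
        rw [← Real.exp_add]
        exact Real.exp_le_exp.2 (by nlinarith)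
      linarith
    _ ≤ _ := by
      rw [ENNReal.ofReal_mul hK, ENNReal.ofReal_add (div_nonneg (by simpa using hmono) hZ.le)
        (by positivity), ← texp_Icc hl ha0 ha1 le_rfl]
      gcongr

end Texp

/-! ### The margin of the largest shifted value -/

section Gap

variable {V : Type*} [Fintype V] {lam : ℝ}

/-- Coins in `[0,1]` are what `shift_bounds` needs: the natural-number floor then rounds correctly
and `D - δ` is a true subtraction. -/
theorem pi_texp_compl (hl : 0 < lam) :
    (Measure.pi fun _ : V => texp lam) {ω | ∀ i, ω i ∈ Set.Icc (0 : ℝ) 1}ᶜ = 0 := by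
  have := isProbabilityMeasure_texp hl
  have h : {ω : V → ℝ | ∀ i, ω i ∈ Set.Icc (0 : ℝ) 1}ᶜ =
      ⋃ i, Function.eval i ⁻¹' (Set.Icc (0 : ℝ) 1)ᶜ := by
    ext ω
    simp
  rw [h]
  exact measure_iUnion_null fun i => by
    rw [(measurePreserving_eval (fun _ : V => texp lam) i).measure_preimage
      measurableSet_Icc.compl.nullMeasurableSet, texp_compl_Icc]

/-- The shifted value at `x` beats all others in `N`, but not by a margin of more than `ρ`. -/
def narrowWin (N : Finset V) (b : V → ℝ) (ρ : ℝ) (x : V) : Set (V → ℝ) :=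
  {ω | (∀ y ∈ N, y ≠ x → ω y - b y ≤ ω x - b x) ∧
    ∃ y ∈ N, y ≠ x ∧ ω x - b x ≤ ω y - b y + ρ}

/-- The shifted value at `x` beats all others in `N` strictly. -/
def strictWin (N : Finset V) (b : V → ℝ) (x : V) : Set (V → ℝ) :=
  {ω | ∀ y ∈ N, y ≠ x → ω y - b y < ω x - b x}

theorem measurableSet_narrowWin (N : Finset V) (b : V → ℝ) (ρ : ℝ) (x : V) :
    MeasurableSet (narrowWin N b ρ x) := by
  unfold narrowWin
  measurability

theorem measurableSet_strictWin (N : Finset V) (b : V → ℝ) (x : V) :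
    MeasurableSet (strictWin N b x) := by
  unfold strictWin
  measurability

theorem pi_narrowWin_le (hl : 0 < lam) (N : Finset V) (b : V → ℝ) {ρ : ℝ} (hρ : 0 ≤ ρ) (x : V) :
    (Measure.pi fun _ : V => texp lam) (narrowWin N b ρ x) ≤
      ENNReal.ofReal (1 - Real.exp (-(ρ * lam))) *
        ((Measure.pi fun _ : V => texp lam) (strictWin N b x) +
          ENNReal.ofReal (1 / (Real.exp lam - 1))) := by
  classical
  have := isProbabilityMeasure_texp hl
  have hF := measurableSet_narrowWin N b ρ x
  have hE := measurableSet_strictWin N b x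
  set K := ENNReal.ofReal (1 - Real.exp (-(ρ * lam)))
  set e := ENNReal.ofReal (1 / (Real.exp lam - 1))
  have hg : Measurable fun ω => K * ((strictWin N b x).indicator 1 ω + e) :=
    ((measurable_one.indicator hE).add_const e).const_mul K
  -- By independence it suffices to integrate over coordinate `x` with the others fixed.
  have key := lintegral_le_of_lmarginal_le (μ := fun _ : V => texp lam) {x}
    (measurable_one.indicator hF) hg ?_
  · rw [lintegral_indicator_one hF,
      lintegral_const_mul _ ((measurable_one.indicator hE).add_const e),
      lintegral_add_right _ measurable_const, lintegral_indicator_one hE] at key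
    simpa using key
  intro ω
  rw [lmarginal_singleton, lmarginal_singleton]
  simp only
  have hup : Measurable fun t : ℝ => Function.update ω x t := measurable_update ω
  have hF' := hup hF
  have hE' := hup hE
  have e1 : ∀ S : Set (V → ℝ),
      (fun t : ℝ => S.indicator (1 : (V → ℝ) → ℝ≥0∞) (Function.update ω x t)) =
      ((fun t : ℝ => Function.update ω x t) ⁻¹' S).indicator 1 := fun S => rfl
  have hm : Measurable fun t : ℝ =>
      (strictWin N b x).indicator (1 : (V → ℝ) → ℝ≥0∞) (Function.update ω x t) + e :=
    ((measurable_one.indicator hE).comp hup).add_const e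
  rw [lintegral_const_mul _ hm, lintegral_add_right _ measurable_const, e1, e1,
    lintegral_indicator_one hF', lintegral_indicator_one hE', lintegral_const, measure_univ, mul_one]
  by_cases hN : (N.erase x).Nonempty
  · obtain ⟨z, hz, hmax⟩ := (N.erase x).exists_max_image (fun y => ω y - b y) hN
    rw [Finset.mem_erase] at hz
    -- The value that `ω x` must reach to tie with its best competitor: narrow wins lie in `[r, r +
    -- ρ]`, and every value above `r` wins strictly.
    set r := ω z - b z + b x with hr
    refine (measure_mono ?_).trans ((texp_window_le hl (r := r) hρ).trans ?_)
    · rintro t ⟨h1, y, hy, hyx, h2⟩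
      have h1 := h1 z hz.2 hz.1
      have h3 := hmax y (Finset.mem_erase.2 ⟨hyx, hy⟩)
      simp only [Function.update_self, Function.update_of_ne hyx, Function.update_of_ne hz.1] at h1 h2
      constructor <;> linarith
    · gcongr
      intro t ht y hy hyx
      have h3 := hmax y (Finset.mem_erase.2 ⟨hyx, hy⟩)
      simp only [Function.update_self, Function.update_of_ne hyx]
      have : r < t := ht
      linarith
  -- Without a competitor there is no narrow win.
  · have : (fun t : ℝ => Function.update ω x t) ⁻¹' narrowWin N b ρ x = ∅ := by
      ext t
      simp only [Set.mem_preimage, Set.mem_empty_iff_false, iff_false]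
      rintro ⟨-, y, hy, hyx, -⟩
      exact hN ⟨y, Finset.mem_erase.2 ⟨hyx, hy⟩⟩
    simp [this]

/-- With good probability, the largest shifted value among `N` exceeds all others by more
than `ρ`. -/
theorem pi_texp_gap (hl : 0 < lam) {N : Finset V} (hN : N.Nonempty) (b : V → ℝ) {ρ : ℝ}
    (hρ : 0 ≤ ρ) :
    1 - (1 - Real.exp (-(ρ * lam))) * (1 + N.card / (Real.exp lam - 1)) ≤
      (Measure.pi fun _ : V => texp lam).real {ω | (∀ i, ω i ∈ Set.Icc (0 : ℝ) 1) ∧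
        ∃ x ∈ N, ∀ y ∈ N, y ≠ x → ω y - b y + ρ < ω x - b x} := by
  classical
  have := isProbabilityMeasure_texp hl
  set P := Measure.pi fun _ : V => texp lam
  set S := {ω : V → ℝ | (∀ i, ω i ∈ Set.Icc (0 : ℝ) 1) ∧
        ∃ x ∈ N, ∀ y ∈ N, y ≠ x → ω y - b y + ρ < ω x - b x}
  have he : 0 < Real.exp lam - 1 := by simpa using hl
  have hK : 0 ≤ 1 - Real.exp (-(ρ * lam)) := by
    have : 0 ≤ ρ * lam := by positivity
    simpa using this
  have hsub : Sᶜ ⊆ {ω | ∀ i, ω i ∈ Set.Icc (0 : ℝ) 1}ᶜ ∪ ⋃ x ∈ N, narrowWin N b ρ x := by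
    intro ω hω
    by_cases h : ∀ i, ω i ∈ Set.Icc (0 : ℝ) 1
    · right
      obtain ⟨x, hx, hmax⟩ := N.exists_max_image (fun y => ω y - b y) hN
      simp only [Set.mem_iUnion]
      refine ⟨x, hx, fun y hy _ => hmax y hy, ?_⟩
      by_contra! hcon
      exact hω ⟨h, x, hx, hcon⟩
    · exact .inl h
  -- Disjointness makes the main terms sum to at most `1`, so the union bound loses no factor
  -- `N.card` there.
  have hdisj : (N : Set V).PairwiseDisjoint (strictWin N b) := by
    intro x hx y hy hxy
    refine Set.disjoint_left.2 fun ω h1 h2 => ?_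
    exact lt_asymm (h1 y hy hxy.symm) (h2 x hx hxy)
  have hsum : ∑ x ∈ N, P (strictWin N b x) ≤ 1 := by
    rw [← measure_biUnion_finset hdisj fun x _ => measurableSet_strictWin N b x]
    exact prob_le_one
  have hbound : P Sᶜ ≤ ENNReal.ofReal
      ((1 - Real.exp (-(ρ * lam))) * (1 + N.card / (Real.exp lam - 1))) := by
    calc P Sᶜ ≤ _ := measure_mono hsub
      _ ≤ P {ω | ∀ i, ω i ∈ Set.Icc (0 : ℝ) 1}ᶜ + ∑ x ∈ N, P (narrowWin N b ρ x) :=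
        (measure_union_le _ _).trans (add_le_add le_rfl (measure_biUnion_finset_le _ _))
      _ ≤ 0 + ∑ x ∈ N, ENNReal.ofReal (1 - Real.exp (-(ρ * lam))) *
          (P (strictWin N b x) + ENNReal.ofReal (1 / (Real.exp lam - 1))) := by
        gcongr with x hx
        · exact (pi_texp_compl hl).le
        · exact pi_narrowWin_le hl N b hρ x
      _ = ENNReal.ofReal (1 - Real.exp (-(ρ * lam))) *
          (∑ x ∈ N, P (strictWin N b x) + N.card * ENNReal.ofReal (1 / (Real.exp lam - 1))) := by
        rw [zero_add, ← Finset.mul_sum, Finset.sum_add_distrib, Finset.sum_const, nsmul_eq_mul]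
      _ ≤ ENNReal.ofReal (1 - Real.exp (-(ρ * lam))) *
          (1 + N.card * ENNReal.ofReal (1 / (Real.exp lam - 1))) := by gcongr
      _ = _ := by
        rw [ENNReal.ofReal_mul hK, ENNReal.ofReal_add zero_le_one (by positivity),
          div_eq_mul_one_div (N.card : ℝ), ENNReal.ofReal_mul (by positivity), ENNReal.ofReal_one,
          ENNReal.ofReal_natCast]
  have h1 : P.real Sᶜ ≤ (1 - Real.exp (-(ρ * lam))) * (1 + N.card / (Real.exp lam - 1)) :=
    ENNReal.toReal_le_of_le_ofReal (by positivity) hbound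
  have h2 : 1 ≤ P.real S + P.real Sᶜ := by
    rw [← probReal_univ (μ := P), ← Set.union_compl_self S]
    exact measureReal_union_le _ _
  linarith

end Gap

/-! ### Numerical estimate for the parameter `2 + 2 log T` -/

/-- The lower bound on the padding probability, with `k ≤ T` competing centers, padding window `ρ`
and rounding error `s`. -/
theorem exp_le_one_sub_window {T k ρ s : ℝ} (hT : 1 ≤ T) (hk0 : 0 ≤ k) (hk : k ≤ T) (hρ0 : 0 ≤ ρ)
    (hρ : ρ ≤ 1 / 2) (hs : 0 ≤ s) :
    Real.exp (-(2 * ρ * (2 + 2 * Real.log T))) - 2 * s * (2 + 2 * Real.log T) ≤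
      1 - (1 - Real.exp (-((ρ + s) * (2 + 2 * Real.log T)))) *
        (1 + k / (Real.exp (2 + 2 * Real.log T) - 1)) := by
  set lam := 2 + 2 * Real.log T with hlam
  have hlog : 0 ≤ Real.log T := Real.log_nonneg hT
  have hl : 0 < lam := by positivity
  set t := Real.exp 1 * T with ht
  have he1 : 2.7 < Real.exp 1 := lt_trans (by norm_num) Real.exp_one_gt_d9
  have hthalf : Real.exp (lam / 2) = t := by
    rw [hlam, add_div, Real.exp_add, mul_div_cancel_left₀ _ two_ne_zero,
      Real.exp_log (by linarith)]
    norm_num [ht]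
  have htsq : Real.exp lam = t ^ 2 := by
    rw [← hthalf, ← Real.exp_nat_mul]
    congr 1
    push_cast
    ring
  have ht1 : 2.7 * T ≤ t := by rw [ht]; gcongr
  have hden : 0 < t ^ 2 - 1 := by nlinarith
  rw [htsq]
  set δ := k / (t ^ 2 - 1) with hδ
  have hδ0 : 0 ≤ δ := div_nonneg hk0 hden.le
  -- From `k ≤ T ≤ t / 2.7` and `t ≥ 2.7`: `t * k ≤ t² / 2.7 ≤ (t² - 1) / 2`.
  have hδt : t * δ ≤ 1 / 2 := by
    rw [hδ, ← mul_div_assoc, div_le_iff₀ hden]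
    nlinarith
  have hδ1 : δ ≤ 1 := by nlinarith
  set X := Real.exp (ρ * lam) with hX
  have hX1 : 1 ≤ X := Real.one_le_exp (by positivity)
  have hXt : X ≤ t := by
    rw [← hthalf]
    exact Real.exp_le_exp.2 (by nlinarith)
  have hXinv : Real.exp (-(ρ * lam)) = X⁻¹ := Real.exp_neg _
  have hX0 : 0 < X := by positivity
  have hXρ : X - 1 ≤ ρ * lam * X := by
    have h1 := Real.add_one_le_exp (-(ρ * lam))
    rw [hXinv] at h1
    have h2 : (-(ρ * lam) + 1) * X ≤ X⁻¹ * X := by gcongr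
    rw [inv_mul_cancel₀ hX0.ne'] at h2
    linarith
  set y := (X - 1) * δ with hy
  have hy0 : 0 ≤ y := mul_nonneg (by linarith) hδ0
  have hy1 : y ≤ 1 / 2 := by nlinarith
  have hy2 : 2 * y ≤ ρ * lam := by
    have h1 : y ≤ ρ * lam * X * δ := by rw [hy]; gcongr
    have h2 : X * δ ≤ 1 / 2 := le_trans (by gcongr) hδt
    have h3 : ρ * lam * (X * δ) ≤ ρ * lam * (1 / 2) := by gcongr
    linarith
  have hexpy : Real.exp (-(ρ * lam)) ≤ 1 - y := by
    calc Real.exp (-(ρ * lam)) ≤ Real.exp (-(2 * y)) := Real.exp_le_exp.2 (by linarith)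
      _ = (Real.exp (2 * y))⁻¹ := Real.exp_neg _
      _ ≤ (1 + 2 * y)⁻¹ := by
        gcongr
        linarith [Real.add_one_le_exp (2 * y)]
      -- Here `y ≤ 1/2` enters: `(1 - y)(1 + 2y) = 1 + y(1 - 2y)`.
      _ ≤ 1 - y := by
        rw [inv_le_iff_one_le_mul₀ (by positivity)]
        nlinarith
  have hmain : Real.exp (-(2 * ρ * lam)) ≤ 1 - (1 - Real.exp (-(ρ * lam))) * (1 + δ) := by
    -- The truncation error becomes the factor `1 - y`, which is at least another `e^(-ρλ)`; hence
    -- the doubled exponent.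
    have h1 : 1 - (1 - Real.exp (-(ρ * lam))) * (1 + δ) = Real.exp (-(ρ * lam)) * (1 - y) := by
      rw [hXinv, hy]
      field_simp
      ring
    rw [h1, show -(2 * ρ * lam) = -(ρ * lam) + -(ρ * lam) by ring, Real.exp_add]
    gcongr
  have hround : Real.exp (-(ρ * lam)) - Real.exp (-((ρ + s) * lam)) ≤ s * lam := by
    rw [show -((ρ + s) * lam) = -(ρ * lam) + -(s * lam) by ring, Real.exp_add]
    have h1 := Real.add_one_le_exp (-(s * lam))
    have h2 : Real.exp (-(ρ * lam)) ≤ 1 := Real.exp_le_one_iff.2 (by nlinarith [mul_nonneg hρ0 hl.le])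
    have h3 : 0 < Real.exp (-(ρ * lam)) := Real.exp_pos _
    have h4 : 0 ≤ s * lam := by positivity
    nlinarith
  have h5 : (Real.exp (-(ρ * lam)) - Real.exp (-((ρ + s) * lam))) * (1 + δ) ≤ s * lam * 2 :=
    mul_le_mul hround (by linarith) (by positivity) (by positivity)
  linarith

/-! ### From the margin to padded balls -/

section Padding

variable {V : Type*} {w n τ c : ℕ} {N : Network w V} {D ε : ℝ≥0} {A : SetSSPAlg V}

/-- The rounded shift, in units of `D`. -/
theorem shift_bounds {D : ℝ≥0} {m : ℕ} (hm : 0 < m) {x : ℝ} (hx : x ∈ Set.Icc (0 : ℝ) 1) :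
    shift D m x ≤ D ∧ (shift D m x : ℝ) ≤ D * x ∧ D * (x - 1 / m) ≤ (shift D m x : ℝ) := by
  have hm' : (0 : ℝ) < m := by exact_mod_cast hm
  have h1 : ((⌊m * x⌋₊ : ℝ) / m) ≤ x := by
    rw [div_le_iff₀ hm', mul_comm x]
    exact Nat.floor_le (mul_nonneg hm'.le hx.1)
  have h2 : x - 1 / m ≤ (⌊m * x⌋₊ : ℝ) / m := by
    rw [le_div_iff₀ hm', sub_mul, one_div_mul_cancel hm'.ne']
    linarith [Nat.lt_floor_add_one (m * x)]
  have h3 : (shift D m x : ℝ) = D * ((⌊m * x⌋₊ : ℝ) / m) := by simp [shift]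
  have h4 : (shift D m x : ℝ) ≤ D * x := by
    rw [h3]
    gcongr
  refine ⟨?_, h4, ?_⟩
  · rw [← NNReal.coe_le_coe]
    nlinarith [hx.2, D.coe_nonneg]
  · rw [h3]
    gcongr

/-- The root of a node of the ball around `v` is a center near `v`. -/
theorem dist_root_le {root : V → V} {v : V} {γ : ℝ≥0}
    (hcov : ∀ v : V, ∃ x ∈ N.centers, N.G.dist v x ≤ D) (hγ : γ ≤ 1 / 32) (hεγ : ε ≤ γ)
    {u : V} (hu : u ∈ N.G.ball v (γ * D))
    {δ : V → ℝ≥0} {p : N.G.graph.Walk u (root u)}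
    (hp : ∀ x ∈ N.centers, (N.G.walkLen p : ℝ≥0∞) + (D - δ (root u) : ℝ≥0) ≤
          (1 + ε : ℝ≥0) * (N.G.dist u x + (D - δ x : ℝ≥0))) :
    N.G.dist v (root u) ≤ (6 * D : ℝ≥0) := by
  obtain ⟨x, hx, hux⟩ := hcov u
  have h1 : (N.G.walkLen p : ℝ≥0∞) ≤ (1 + ε : ℝ≥0) * ((D : ℝ≥0∞) + D) := by
    refine le_self_add.trans ((hp x hx).trans ?_)
    gcongr
    exact tsub_le_self
  have h2 : N.G.walkLen p ≤ (1 + ε) * (D + D) := by exact_mod_cast h1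
  calc N.G.dist v (root u) ≤ N.G.dist v u + N.G.dist u (root u) := N.G.dist_triangle _ _ _
    _ ≤ (γ * D : ℝ≥0) + (N.G.walkLen p : ℝ≥0) := add_le_add hu (N.G.dist_le_walkLen p)
    _ ≤ (6 * D : ℝ≥0) := by
      norm_cast
      -- The sum is `67/32` times `D`, well below `6D`.
      have : γ * D + N.G.walkLen p ≤ (1 / 32) * D + (1 + 1 / 32) * (D + D) := by
        refine add_le_add (by gcongr) (h2.trans ?_)
        gcongr
        exact hεγ.trans hγ
      refine this.trans ?_
      rw [← NNReal.coe_le_coe]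
      push_cast
      nlinarith [D.coe_nonneg]

variable [Fintype V]

/-- If the largest shifted value among the near centers exceeds the others by a sufficient margin,
the ball around `v` lies in one cluster. -/
theorem ball_subset_cluster_of_gap (hD : 0 < D) (hcov : ∀ v : V, ∃ x ∈ N.centers, N.G.dist v x ≤ D)
    (hA : A.Solves N.G ε 1 D) {ω : V → ℝ} (hω : ∀ i, ω i ∈ Set.Icc (0 : ℝ) 1) (hn : 0 < n)
    {v : V} {γ : ℝ≥0} (hεγ : ε ≤ γ) (hγ : γ ≤ 1 / 32) {x : V}
    (hx : x ∈ N.centers) (hvx : N.G.dist v x ≤ (6 * D : ℝ≥0))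
    (hgap : ∀ y ∈ N.centers, N.G.dist v y ≤ (6 * D : ℝ≥0) → y ≠ x →
      ω y - (N.G.dist v y).toReal / D + (2 * γ + 3 * ε + 1 / (n ^ (c + 1) : ℕ)) <
        ω x - (N.G.dist v x).toReal / D) :
    N.G.ball v (γ * D) ⊆ (paddedDecomposition w n τ c D).cluster N A ω v := by
  obtain ⟨root, hcl, hroot⟩ := exists_root (n := n) (τ := τ) (c := c) hcov hA ω
  have hm : 0 < n ^ (c + 1) := pow_pos hn _
  set m := n ^ (c + 1)
  have hD' : (0 : ℝ) < D := hD
  have hfin : ∀ y, N.G.dist v y ≤ (6 * D : ℝ≥0) → N.G.dist v y = ((N.G.dist v y).toNNReal : ℝ≥0∞) :=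
    fun y hy => (ENNReal.coe_toNNReal (ne_top_of_le_ne_top ENNReal.coe_ne_top hy)).symm
  -- the gap in terms of the rounded shifts
  have hgap' : ∀ y ∈ N.centers, N.G.dist v y ≤ (6 * D : ℝ≥0) → y ≠ x →
      ((N.G.dist v x).toReal - shift D m (ω x)) + (2 * γ + 3 * ε) * D <
        (N.G.dist v y).toReal - shift D m (ω y) := by
    intro y hy hvy hyx
    have h1 := mul_lt_mul_of_pos_left (hgap y hy hvy hyx) hD'
    obtain ⟨-, hy1, -⟩ := shift_bounds (D := D) hm (hω y)
    obtain ⟨-, -, hx2⟩ := shift_bounds (D := D) hm (hω x)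
    have e1 : (D : ℝ) * ((N.G.dist v y).toReal / D) = (N.G.dist v y).toReal :=
      mul_div_cancel₀ _ hD'.ne'
    have e2 : (D : ℝ) * ((N.G.dist v x).toReal / D) = (N.G.dist v x).toReal :=
      mul_div_cancel₀ _ hD'.ne'
    rw [mul_add, mul_sub, mul_sub, e1, e2, mul_add] at h1
    rw [mul_sub] at hx2
    linarith
  -- The winner is no worse than the covering center of `v`. This turns the multiplicative error `ε`
  -- into an additive one.
  have hxmin : (N.G.dist v x).toReal - shift D m (ω x) ≤ D := by
    obtain ⟨x₀, hx₀, hd₀⟩ := hcov v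
    have h6 : N.G.dist v x₀ ≤ (6 * D : ℝ≥0) := hd₀.trans (by
      norm_cast
      rw [← NNReal.coe_le_coe]
      push_cast
      linarith)
    have h0 : (N.G.dist v x₀).toReal ≤ D := by
      have := ENNReal.toReal_mono ENNReal.coe_ne_top hd₀
      simpa using this
    by_cases hne : x₀ = x
    · subst hne
      linarith [(shift D m (ω x₀)).coe_nonneg]
    · have h1 := hgap' x₀ hx₀ h6 hne
      have h2 : 0 ≤ (2 * (γ : ℝ) + 3 * ε) * D := by positivity
      linarith [(shift D m (ω x₀)).coe_nonneg]
  have key : ∀ u ∈ N.G.ball v (γ * D), root u = x := by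
    intro u hu
    obtain ⟨hz, p, -, hp⟩ := hroot u
    have hvz := dist_root_le (δ := fun y => shift D m (ω y)) hcov hγ hεγ hu hp
    by_contra hne
    have hg := hgap' _ hz hvz hne
    have hu' : N.G.dist v u ≤ (γ * D : ℝ≥0) := hu
    have h1 : N.G.dist v (root u) ≤ (γ * D : ℝ≥0) + (N.G.walkLen p : ℝ≥0) :=
      (N.G.dist_triangle _ _ _).trans (add_le_add hu' (N.G.dist_le_walkLen p))
    have h2 := (hp x hx).trans (mul_le_mul_right (add_le_add_left
      ((N.G.dist_triangle u v x).trans (add_le_add_left ((N.G.dist_comm u v).trans_le hu') _)) _) _)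
    have hza := hfin _ hvz
    have hxa := hfin _ hvx
    have hzR : (N.G.dist v (root u)).toReal = ((N.G.dist v (root u)).toNNReal : ℝ) := rfl
    have hxR : (N.G.dist v x).toReal = ((N.G.dist v x).toNNReal : ℝ) := rfl
    rw [hzR, hxR] at hg
    rw [hxR] at hxmin
    rw [hza] at h1
    rw [hxa] at h2
    generalize (N.G.dist v (root u)).toNNReal = az at *
    generalize (N.G.dist v x).toNNReal = ax at *
    have h1' : az ≤ γ * D + N.G.walkLen p := by exact_mod_cast h1
    have h2' : N.G.walkLen p + (D - shift D m (ω (root u))) ≤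
        (1 + ε) * (γ * D + ax + (D - shift D m (ω x))) := by exact_mod_cast h2
    obtain ⟨hz1, -, -⟩ := shift_bounds (D := D) hm (hω (root u))
    obtain ⟨hx1, -, -⟩ := shift_bounds (D := D) hm (hω x)
    rw [← NNReal.coe_le_coe] at h1' h2'
    push_cast [NNReal.coe_sub hz1, NNReal.coe_sub hx1] at h1' h2'
    have hγ' : (γ : ℝ) ≤ 1 / 32 := by exact_mod_cast hγ
    set B := (γ : ℝ) * D + ax + (D - shift D m (ω x)) with hB
    -- The margin `2γ + 3ε` is explained here: moving between `v` and `u` costs `γ * D` for each of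
    -- the two centers, and the approximation costs `ε * B`.
    have hB3 : B ≤ 3 * D := by nlinarith
    have : (ε : ℝ) * B ≤ ε * (3 * D) := by gcongr
    nlinarith
  intro u hu
  rw [hcl]
  exact (key u hu).trans (key v (N.G.mem_ball_self v _)).symm

/-- If only one center is near `v`, the ball around `v` lies in one cluster. -/
theorem ball_subset_cluster_of_subsingleton {v : V}
    (hcov : ∀ v : V, ∃ x ∈ N.centers, N.G.dist v x ≤ D)
    (hA : A.Solves N.G ε 1 D) (ω : V → ℝ) {γ : ℝ≥0} (hεγ : ε ≤ γ) (hγ : γ ≤ 1 / 32)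
    (hsub : {x ∈ N.centers | N.G.dist v x ≤ (6 * D : ℝ≥0)}.Subsingleton) :
    N.G.ball v (γ * D) ⊆ (paddedDecomposition w n τ c D).cluster N A ω v := by
  obtain ⟨root, hcl, hroot⟩ := exists_root (n := n) (τ := τ) (c := c) hcov hA ω
  have key : ∀ u ∈ N.G.ball v (γ * D), root u ∈ {x ∈ N.centers | N.G.dist v x ≤ (6 * D : ℝ≥0)} := by
    intro u hu
    obtain ⟨hz, p, -, hp⟩ := hroot u
    exact ⟨hz, dist_root_le (δ := fun y => shift D (n ^ (c + 1)) (ω y)) hcov hγ hεγ hu hp⟩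
  intro u hu
  rw [hcl]
  exact hsub (key u hu) (key v (N.G.mem_ball_self v _))

/-- The padding property of the clustering algorithm. -/
theorem padding_probability (hD : 0 < D) (hcov : ∀ v : V, ∃ x ∈ N.centers, N.G.dist v x ≤ D)
    (hpack : ∀ v : V, {x ∈ N.centers | N.G.dist v x ≤ (6 * D : ℝ≥0)}.ncard ≤ τ)
    (hA : A.Solves N.G ε 1 D) (v : V) {γ : ℝ≥0} (hεγ : ε ≤ γ) (hγ : γ ≤ 1 / 32) :
    Real.exp (-(30 * ((γ + ε) * Real.log τ))) - 4 / (Fintype.card V : ℝ) ^ c ≤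
      ((paddedDecomposition w (Fintype.card V) τ c D).law V).real
        {ω | N.G.ball v (γ * D) ⊆
          (paddedDecomposition w (Fintype.card V) τ c D).cluster N A ω v} := by
  classical
  set n := Fintype.card V with hn
  have hn0 : 0 < n := Fintype.card_pos_iff.2 ⟨v⟩
  set S := {x ∈ N.centers | N.G.dist v x ≤ (6 * D : ℝ≥0)} with hS
  have hSne : S.Nonempty := by
    obtain ⟨x, hx, hd⟩ := hcov v
    refine ⟨x, hx, hd.trans ?_⟩
    norm_cast
    rw [← NNReal.coe_le_coe]
    push_cast
    linarith [D.coe_nonneg]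
  have hcardS : S.toFinset.card = S.ncard := (Set.ncard_eq_toFinset_card' S).symm
  have hSpos : 0 < S.ncard := (Set.ncard_pos S.toFinite).2 hSne
  set T := min τ n with hT
  have hST : S.ncard ≤ T := le_min (hpack v) (by
    rw [← hcardS]
    exact Finset.card_le_univ _)
  have hT1 : (1 : ℝ) ≤ T := by exact_mod_cast hSpos.trans_le hST
  set lam := 2 + 2 * Real.log (T : ℝ) with hlam
  have hl : 0 < lam := by have := Real.log_nonneg hT1; positivity
  have hlaw : (paddedDecomposition w n τ c D).law V = Measure.pi fun _ : V => texp lam := rfl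
  have := isProbabilityMeasure_texp hl
  rw [hlaw]
  have hn1 : (1 : ℝ) ≤ n := by exact_mod_cast hn0
  -- Here `log τ = 0`, so no multiple of it bounds `lam`; but a single near center makes padding
  -- certain.
  by_cases hτ : τ ≤ 1
  · have huniv : {ω | N.G.ball v (γ * D) ⊆ (paddedDecomposition w n τ c D).cluster N A ω v} =
        Set.univ := by
      refine Set.eq_univ_of_forall fun ω => ball_subset_cluster_of_subsingleton hcov hA ω hεγ hγ ?_
      exact (Set.ncard_le_one S.toFinite).1 ((hpack v).trans hτ) |> fun h a ha b hb => h a ha b hb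
    rw [huniv, probReal_univ]
    have h1 : Real.exp (-(30 * ((γ + ε) * Real.log τ))) ≤ 1 :=
      Real.exp_le_one_iff.2 (neg_nonpos.2 (by have := Real.log_natCast_nonneg τ; positivity))
    have h2 : 0 ≤ 4 / (n : ℝ) ^ c := by positivity
    linarith
  push Not at hτ
  have hτ2 : (2 : ℝ) ≤ τ := by exact_mod_cast hτ
  set m := n ^ (c + 1) with hm
  have hsub : {ω : V → ℝ | (∀ i, ω i ∈ Set.Icc (0 : ℝ) 1) ∧ ∃ x ∈ S.toFinset, ∀ y ∈ S.toFinset,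
      y ≠ x → ω y - (N.G.dist v y).toReal / D + ((2 * γ + 3 * ε) + 1 / (m : ℕ)) <
        ω x - (N.G.dist v x).toReal / D} ⊆
      {ω | N.G.ball v (γ * D) ⊆ (paddedDecomposition w n τ c D).cluster N A ω v} := by
    rintro ω ⟨hω, x, hx, hgap⟩
    rw [Set.mem_toFinset] at hx
    exact ball_subset_cluster_of_gap hD hcov hA hω hn0 hεγ hγ hx.1 hx.2
      fun y hy hvy hyx => hgap y (Set.mem_toFinset.2 ⟨hy, hvy⟩) hyx
  refine le_trans ?_ ((pi_texp_gap hl (Set.toFinset_nonempty.2 hSne)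
    (fun y => (N.G.dist v y).toReal / D) (by positivity)).trans (measureReal_mono hsub))
  rw [hcardS]
  have hγ' : (γ : ℝ) ≤ 1 / 32 := by exact_mod_cast hγ
  have hεγ' : (ε : ℝ) ≤ γ := hεγ
  refine le_trans ?_ (exp_le_one_sub_window hT1 (by positivity) (by exact_mod_cast hST)
    (by positivity) (by linarith) (by positivity))
  rw [← hlam]
  have hlogτ : 0.69 < Real.log τ := by
    have := Real.log_le_log two_pos hτ2
    linarith [Real.log_two_gt_d9]
  -- Uses `2 ≤ 3 * log τ`, valid since `0.69 > 2/3`.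
  have hlamτ : lam ≤ 5 * Real.log τ := by
    have h1 : Real.log T ≤ Real.log τ :=
      Real.log_le_log (by linarith) (by exact_mod_cast min_le_left _ _)
    linarith
  have hlamn : lam ≤ 2 * n := by
    have h1 : Real.log T ≤ Real.log n :=
      Real.log_le_log (by linarith) (by exact_mod_cast min_le_right _ _)
    have h2 := Real.log_le_sub_one_of_pos (show (0 : ℝ) < n by linarith)
    linarith
  refine sub_le_sub (Real.exp_le_exp.2 (neg_le_neg ?_)) ?_
  -- The constant `30` is `2 * 3 * 5`.
  · calc 2 * (2 * (γ : ℝ) + 3 * ε) * lam ≤ 2 * (3 * (γ + ε)) * (5 * Real.log τ) := by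
          gcongr
          linarith [γ.coe_nonneg]
      _ = _ := by ring
  -- The extra factor `n` in the precision `1 / n ^ (c + 1)` pays for `lam ≤ 2 * n`.
  · calc 2 * (1 / (m : ℝ)) * lam ≤ 2 * (1 / (m : ℝ)) * (2 * n) := by gcongr
      _ = 4 / (n : ℝ) ^ c := by
        rw [hm]
        push_cast
        rw [pow_succ]
        field_simp
        norm_num

end Padding

end PseudoPadded

open PseudoPadded in
theorem mainTheorem5 :
    ∃ C : ℝ, 0 < C ∧ ∀ c : ℕ, ∃ C' : ℝ, 0 < C' ∧
      ∀ (V : Type*) [Fintype V] (w : ℕ) (N : Network w V) (D ε : ℝ≥0) (τ : ℕ),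
        0 < D →
        -- covering property
        (∀ v : V, ∃ x ∈ N.centers, N.G.dist v x ≤ D) →
        -- packing property
        (∀ v : V, {x ∈ N.centers | N.G.dist v x ≤ (6 * D : ℝ≥0)}.ncard ≤ τ) →
        ∃ P : Program w (PadState w), P = paddedDecomposition w (Fintype.card V) τ c D ∧
          -- one shortest path computation, one minor aggregation, messages as long as identifiers
          P.numSetSSP = 1 ∧ P.numMinorAgg = 1 ∧ (∀ i ∈ P.steps, i.bits ≤ w) ∧
          ∀ A : SetSSPAlg V, A.Solves N.G ε 1 D →
            -- connected clusters of strong diameter `4 (1 + ε) D`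
            (∀ (ω : V → ℝ) (v : V),
              (N.G.graph.induce (P.cluster N A ω v)).Connected ∧
              N.G.StrongDiamLE (P.cluster N A ω v) (4 * (1 + ε) * D)) ∧
            -- padding property
            ∀ (v : V) (γ : ℝ≥0), ε ≤ γ → γ ≤ 1 / 32 →
              Real.exp (-(C * ((γ + ε) * Real.log τ))) - C' / (Fintype.card V : ℝ) ^ c ≤
                (P.law V).real {ω | N.G.ball v (γ * D) ⊆ P.cluster N A ω v} := by
  refine ⟨30, by norm_num, fun c => ⟨4, by norm_num, ?_⟩⟩
  intro V _ w N D ε τ hD hcov hpack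
  refine ⟨_, rfl, rfl, rfl, ?_, fun A hA => ⟨fun ω v => ?_, fun v γ hεγ hγ => ?_⟩⟩
  · simp [paddedDecomposition, Instr.bits]
  · exact ⟨connected_cluster hcov hA ω v, strongDiamLE_cluster hcov hA ω v⟩
  · exact padding_probability hD hcov hpack hA v hεγ hγ
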